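/- Let $A_1=A_1(\mathbb R)$ be the first Weyl algebra, i.e. the associative $\mathbb R$-algebra generated by $x,\partial$ subject to $\partial x-x\partial=1$, acting on $C^\infty(\mathbb R)$ by $(xf)(t)=t f(t)$ and $\partial f=f'$ (so its elements act as the differential operators $\sum_{t=0}^T p_t\partial^t$ with real polynomial coefficients). Let $N\sim N(0,1)$, and let $\mathcal F$ be any one of the following classes of functions on $\mathbb R$: the Schwartz functions; the real polynomials; the smooth functions all of whose derivatives have at most polynomial growth; the smooth functions with compact support. Let $$\mathrm{PSO}(N)=\{S\in A_1:\ Sf\in L^1(N)\ \text{and}\ \mathbb E[Sf(N)]=0\ \text{for all } f\in\mathcal F\}$$ be the set of polynomial Stein operators for $N$. Let $H_0=1$, $H_{k+1}=xH_k-H_k'$ be the (probabilist's) Hermite polynomials, and put $G=\partial-x$. Right $A_1$-modules: let $\mathscr F_\nu=\mathrm{span}_{\mathbb R}\{x^\alpha\partial^\beta:\alpha+\beta\le\nu\}$ be the Bernstein filtration. A filtration of a right $A_1$-module $M$ is an increasing sequence of finite-dimensional subspaces $\Gamma_\nu$ $(\nu\ge0)$ with union $M$ and $\Gamma_\nu\mathscr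 F_k\subseteq\Gamma_{\nu+k}$; it is good if $\mathrm{gr}_\Gamma M=\bigoplus_\nu\Gamma_\nu/\Gamma_{\nu-1}$ (with $\Gamma_{-1}=0$) is a finitely generated module over $\mathrm{gr}\,A_1=\bigoplus_\nu\mathscr F_\nu/\mathscr F_{\nu-1}$. For a finitely generated $M$, the Bernstein dimension $d(M)$ is the degree of the polynomial in $\nu$ that $\dim_{\mathbb R}\Gamma_\nu$ agrees with for all large $\nu$, where $\Gamma$ is a good filtration of $M$ (it does not depend on $\Gamma$). $M$ is holonomic if it is finitely generated and $d(M)=1$. Then: (a) $\mathrm{PSO}(N)$ is a real vector space, with basis the operators $S(k,t)=H_k\partial^t-H_{k+t}$, $k\ge0$, $t\ge1$. (b) $\mathrm{PSO}(N)$ is a maximal right ideal of $A_1$, and it is the principal right ideal generated by $G$: $\mathrm{PSO}(N)=GA_1=\{GL: L\in A_1\}$. (c) As a right $A_1$-module, $\mathrm{PSO}(N)$ is not holonomic, and $d(\mathrm{PSO}(N))=2$; the quotient $A_1/\mathrm{PSO}(N)$ is holonomic, and $d(A_1/\mathrm{PSO}(N))=1$. -/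

import Mathlib

open MeasureTheory ProbabilityTheory Polynomial MulOpposite
open scoped ContDiff

noncomputable section

/-! ### The first Weyl algebra -/

/-- The defining relation `∂ x = x ∂ + 1` of the first Weyl algebra, on the free algebra
with two generators (`false` stands for `x`, `true` for `∂`). -/
inductive WeylAlgebra.Rel (K : Type*) [CommRing K] :
    FreeAlgebra K Bool → FreeAlgebra K Bool → Prop
  | comm : WeylAlgebra.Rel K
      (FreeAlgebra.ι K true * FreeAlgebra.ι K false)
      (FreeAlgebra.ι K false * FreeAlgebra.ι K true + 1)

/-- The first Weyl algebra `A₁(K)`: the associative `K`-algebra generated by `x` and `∂`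
subject to `∂ x - x ∂ = 1`. -/
def WeylAlgebra (K : Type*) [CommRing K] : Type _ := RingQuot (WeylAlgebra.Rel K)

namespace WeylAlgebra

instance (K : Type*) [CommRing K] : Ring (WeylAlgebra K) :=
  inferInstanceAs (Ring (RingQuot (WeylAlgebra.Rel K)))

instance (K : Type*) [CommRing K] : Algebra K (WeylAlgebra K) :=
  inferInstanceAs (Algebra K (RingQuot (WeylAlgebra.Rel K)))

/-- The generator `x`. -/
def x (K : Type*) [CommRing K] : WeylAlgebra K :=
  RingQuot.mkAlgHom K (WeylAlgebra.Rel K) (FreeAlgebra.ι K false)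

/-- The generator `∂`. -/
def d (K : Type*) [CommRing K] : WeylAlgebra K :=
  RingQuot.mkAlgHom K (WeylAlgebra.Rel K) (FreeAlgebra.ι K true)

theorem d_mul_x (K : Type*) [CommRing K] : d K * x K = x K * d K + 1 := by
  have h := RingQuot.mkAlgHom_rel K (WeylAlgebra.Rel.comm (K := K))
  rw [map_mul, map_add, map_mul, map_one] at h
  exact h

/-- The universal property: two elements `a`, `b` of a `K`-algebra with `b a = a b + 1`
define an algebra homomorphism with `x ↦ a`, `∂ ↦ b`. -/
def lift {K : Type*} [CommRing K] {B : Type*} [Ring B] [Algebra K B] (a b : B)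
    (h : b * a = a * b + 1) : WeylAlgebra K →ₐ[K] B :=
  RingQuot.liftAlgHom K (s := WeylAlgebra.Rel K)
    ⟨FreeAlgebra.lift K (fun i : Bool => if i then b else a), by
      rintro _ _ ⟨⟩
      simpa using h⟩

theorem lift_x {K : Type*} [CommRing K] {B : Type*} [Ring B] [Algebra K B] (a b : B)
    (h : b * a = a * b + 1) : lift (K := K) a b h (x K) = a := by
  unfold lift x
  erw [RingQuot.liftAlgHom_mkAlgHom_apply]
  simp

theorem lift_d {K : Type*} [CommRing K] {B : Type*} [Ring B] [Algebra K B] (a b : B)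
    (h : b * a = a * b + 1) : lift (K := K) a b h (d K) = b := by
  unfold lift d
  erw [RingQuot.liftAlgHom_mkAlgHom_apply]
  simp

/-- A polynomial `p(x)`, as an element of `A₁(K)`. -/
def ofPoly {K : Type*} [CommRing K] (p : K[X]) : WeylAlgebra K := aeval (x K) p

/-- The Bernstein filtration: `𝓕_ν` is the span of the monomials `x^α ∂^β`, `α + β ≤ ν`. -/
def bernstein (K : Type*) [CommRing K] (ν : ℕ) : Submodule K (WeylAlgebra K) :=
  Submodule.span K {w | ∃ α β : ℕ, α + β ≤ ν ∧ w = x K ^ α * d K ^ β}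

end WeylAlgebra

/-! ### Right modules over the Weyl algebra, good filtrations, Bernstein dimension

A right `A₁(K)`-module is a module over the opposite ring; `op a • m` is `m · a`. -/

/-- A filtration of a right `A₁(K)`-module `M`: an increasing exhaustive sequence of
finite-dimensional `K`-subspaces `Γ_ν` with `Γ_ν · 𝓕_k ⊆ Γ_{ν+k}`. -/
structure WeylFiltration (K : Type*) [Field K] (M : Type*) [AddCommGroup M]
    [Module (WeylAlgebra K)ᵐᵒᵖ M] [Module K M] where
  /-- The subspaces `Γ_ν`. -/
  Γ : ℕ → Submodule K M
  mono : Monotone Γ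
  finite : ∀ ν, Module.Finite K (Γ ν)
  exhaustive : ∀ m : M, ∃ ν, m ∈ Γ ν
  smul_mem : ∀ (k ν : ℕ), ∀ a ∈ WeylAlgebra.bernstein K k, ∀ m ∈ Γ ν, op a • m ∈ Γ (ν + k)

namespace WeylFiltration

variable {K : Type*} [Field K] {M : Type*} [AddCommGroup M]
    [Module (WeylAlgebra K)ᵐᵒᵖ M] [Module K M]

/-- `Γ_{ν-1}`, with `Γ_{-1} = 0`. -/
def pred (F : WeylFiltration K M) : ℕ → Submodule K M
  | 0 => ⊥
  | ν + 1 => F.Γ ν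

theorem smul_pred_mem (F : WeylFiltration K M) (k ν : ℕ) (a : WeylAlgebra K)
    (ha : a ∈ WeylAlgebra.bernstein K k) (m : M) (hm : m ∈ F.pred ν) :
    op a • m ∈ F.pred (ν + k) := by
  cases ν with
  | zero =>
    have h : m = 0 := by simpa [pred] using hm
    subst h
    simp
  | succ n =>
    have h := F.smul_mem k n a ha m hm
    rw [show n + 1 + k = (n + k) + 1 by omega]
    exact h

/-- The homogeneous component `gr_ν M = Γ_ν / Γ_{ν-1}`. -/
abbrev GrPiece (F : WeylFiltration K M) (ν : ℕ) : Type _ :=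
  F.Γ ν ⧸ (F.pred ν).submoduleOf (F.Γ ν)

/-- The associated graded space `gr_Γ M = Γ₀ ⊕ Γ₁/Γ₀ ⊕ Γ₂/Γ₁ ⊕ ⋯`. -/
abbrev Gr (F : WeylFiltration K M) : Type _ := DirectSum ℕ F.GrPiece

/-- `dim_K Γ_ν` is, for large `ν`, a polynomial in `ν` with rational coefficients, of
degree `e`. -/
def HasDegree (F : WeylFiltration K M) (e : ℕ) : Prop :=
  ∃ p : ℚ[X], p.natDegree = e ∧
    ∀ᶠ ν : ℕ in Filter.atTop, (Module.finrank K (F.Γ ν) : ℚ) = p.eval (ν : ℚ)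

variable [IsScalarTower K (WeylAlgebra K)ᵐᵒᵖ M]

/-- The map `m ↦ m · a` from `Γ_ν` to `Γ_{ν+k}`, for `a ∈ 𝓕_k`. -/
def actΓ (F : WeylFiltration K M) (k : ℕ) (a : WeylAlgebra.bernstein K k) (ν : ℕ) :
    F.Γ ν →ₗ[K] F.Γ (ν + k) where
  toFun m := ⟨op (a : WeylAlgebra K) • (m : M), F.smul_mem k ν a a.2 m m.2⟩
  map_add' m m' := by
    ext
    simp
  map_smul' c m := by
    ext
    simp only [Submodule.coe_smul, RingHom.id_apply]
    rw [← algebraMap_smul (WeylAlgebra K)ᵐᵒᵖ c (m : M),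
      ← algebraMap_smul (WeylAlgebra K)ᵐᵒᵖ c (op (a : WeylAlgebra K) • (m : M)),
      smul_smul, smul_smul, Algebra.commutes]

/-- The action on `gr_Γ M` of the class in `gr_k A₁ = 𝓕_k / 𝓕_{k-1}` of an element
`a ∈ 𝓕_k`: it sends the class of `m ∈ Γ_ν` in `Γ_ν / Γ_{ν-1}` to the class of `m · a` in
`Γ_{ν+k} / Γ_{ν+k-1}`. -/
def grAct (F : WeylFiltration K M) (k : ℕ) (a : WeylAlgebra.bernstein K k) :
    F.Gr →ₗ[K] F.Gr :=
  DirectSum.toModule K ℕ F.Gr fun ν =>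
    DirectSum.lof K ℕ F.GrPiece (ν + k) ∘ₗ
      Submodule.mapQ _ _ (F.actΓ k a ν) fun m hm => F.smul_pred_mem k ν a a.2 m hm

/-- The filtration `Γ` is good: `gr_Γ M` is a finitely generated `gr A₁(K)`-module, that is,
for some finite set `s ⊆ gr_Γ M` the only `gr A₁(K)`-submodule containing `s` is `gr_Γ M`.
As the classes of the elements of the `𝓕_k` span `gr A₁(K)`, a subspace is a
`gr A₁(K)`-submodule exactly if it is stable under their actions. -/
def IsGood (F : WeylFiltration K M) : Prop :=
  ∃ s : Finset F.Gr, ∀ N : Submodule K F.Gr, (↑s : Set F.Gr) ⊆ N →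
    (∀ (k : ℕ) (a : WeylAlgebra.bernstein K k), ∀ m ∈ N, F.grAct k a m ∈ N) → N = ⊤

end WeylFiltration

/-- `M` is a finitely generated right `A₁(K)`-module of Bernstein dimension `d(M) = e`: there is
a good filtration `Γ` of `M` for which `dim Γ_ν` is eventually a polynomial of degree `e`, and no
good filtration of `M` yields another degree. -/
def HasBernsteinDim (K : Type*) [Field K] (M : Type*) [AddCommGroup M]
    [Module (WeylAlgebra K)ᵐᵒᵖ M] [Module K M] [IsScalarTower K (WeylAlgebra K)ᵐᵒᵖ M]
    (e : ℕ) : Prop :=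
  Module.Finite (WeylAlgebra K)ᵐᵒᵖ M ∧
    (∃ F : WeylFiltration K M, F.IsGood ∧ F.HasDegree e) ∧
    ∀ F : WeylFiltration K M, F.IsGood → ∀ e' : ℕ, F.HasDegree e' → e' = e

/-- A finitely generated right `A₁(K)`-module is holonomic if its Bernstein dimension is `1`. -/
def IsHolonomic (K : Type*) [Field K] (M : Type*) [AddCommGroup M]
    [Module (WeylAlgebra K)ᵐᵒᵖ M] [Module K M] [IsScalarTower K (WeylAlgebra K)ᵐᵒᵖ M] :
    Prop :=
  HasBernsteinDim K M 1

/-! ### Polynomial differential operators acting on smooth functions -/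

/-- The space `C^∞(ℝ)` of smooth real functions on the line. -/
def smoothFun : Submodule ℝ (ℝ → ℝ) where
  carrier := {f | ContDiff ℝ ∞ f}
  add_mem' {f g} (hf : ContDiff ℝ ∞ f) (hg : ContDiff ℝ ∞ g) :=
    show ContDiff ℝ ∞ (f + g) from ContDiff.add hf hg
  zero_mem' := show ContDiff ℝ ∞ (fun _ : ℝ => (0 : ℝ)) from contDiff_const
  smul_mem' c f (hf : ContDiff ℝ ∞ f) :=
    show ContDiff ℝ ∞ (c • f) from ContDiff.const_smul c hf

theorem smoothFun_contDiff (f : smoothFun) : ContDiff ℝ ∞ (f : ℝ → ℝ) := f.2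

/-- Multiplication by the variable, `f ↦ (t ↦ t f(t))`. -/
def mulVar : Module.End ℝ smoothFun where
  toFun f := ⟨fun t => t * (f : ℝ → ℝ) t, ContDiff.mul contDiff_id (smoothFun_contDiff f)⟩
  map_add' f g := by
    ext t
    simp [mul_add]
  map_smul' c f := by
    ext t
    simp [mul_left_comm]

theorem smoothFun_differentiable (f : smoothFun) : Differentiable ℝ (f : ℝ → ℝ) :=
  (smoothFun_contDiff f).differentiable (by simp)

/-- Differentiation, `f ↦ f'`. -/
def derivOp : Module.End ℝ smoothFun where
  toFun f := ⟨deriv (f : ℝ → ℝ), (contDiff_infty_iff_deriv.mp (smoothFun_contDiff f)).2⟩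
  map_add' f g := by
    ext t
    simpa using deriv_add (smoothFun_differentiable f t) (smoothFun_differentiable g t)
  map_smul' c f := by
    ext t
    simpa using deriv_const_smul c (smoothFun_differentiable f t)

theorem derivOp_mul_mulVar : derivOp * mulVar = mulVar * derivOp + 1 := by
  ext f t
  have h := ((hasDerivAt_id t).mul (smoothFun_differentiable f t).hasDerivAt).deriv
  have h' : deriv (fun t => t * (f : ℝ → ℝ) t) t
      = 1 * (f : ℝ → ℝ) t + t * deriv (f : ℝ → ℝ) t := h
  simp only [Module.End.mul_apply, LinearMap.add_apply, Module.End.one_apply,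
    Submodule.coe_add, Pi.add_apply]
  change deriv (fun t => t * (f : ℝ → ℝ) t) t = t * deriv (f : ℝ → ℝ) t + (f : ℝ → ℝ) t
  rw [h']
  ring

/-- The action of `A₁(ℝ)` on `C^∞(ℝ)`: `∑ p_t(x) ∂^t` sends `f` to `∑ p_t f^{(t)}`. -/
def weylAct : WeylAlgebra ℝ →ₐ[ℝ] Module.End ℝ smoothFun :=
  WeylAlgebra.lift mulVar derivOp derivOp_mul_mulVar

/-! ### Test functions and polynomial Stein operators -/

/-- Polynomial functions. -/
def polyClass : Set smoothFun := {f | ∃ p : ℝ[X], (f : ℝ → ℝ) = fun t => p.eval t}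

/-- Smooth functions with compact support. -/
def compactClass : Set smoothFun := {f | HasCompactSupport (f : ℝ → ℝ)}

/-- Schwartz functions. -/
def schwartzClass : Set smoothFun := {f | ∃ g : SchwartzMap ℝ ℝ, (g : ℝ → ℝ) = f}

/-- Smooth functions all of whose derivatives have at most polynomial growth. -/
def growthClass : Set smoothFun := {f | Function.HasTemperateGrowth (f : ℝ → ℝ)}

/-- `PSO_𝓕(X)` for a real random variable `X` with law `μ`: the differential operators `S` with
polynomial coefficients such that `S f ∈ L¹(μ)` and `E[S f(X)] = 0` for all `f ∈ 𝓕`. -/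
def PSO (𝓕 : Set smoothFun) (μ : Measure ℝ) : Set (WeylAlgebra ℝ) :=
  {S | ∀ f ∈ 𝓕, Integrable (weylAct S f : ℝ → ℝ) μ ∧ ∫ t, (weylAct S f : ℝ → ℝ) t ∂μ = 0}

/-- The operator `G = ∂ - x`. -/
def steinG : WeylAlgebra ℝ := WeylAlgebra.d ℝ - WeylAlgebra.x ℝ

/-- The probabilists' Hermite polynomial `H_k`, with real coefficients. -/
def hermiteR (k : ℕ) : ℝ[X] := (hermite k).map (Int.castRingHom ℝ)

/-- The operator `S(k,t) = H_k ∂^t - H_{k+t}`. -/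
def steinS (k t : ℕ) : WeylAlgebra ℝ :=
  WeylAlgebra.ofPoly (hermiteR k) * WeylAlgebra.d ℝ ^ t - WeylAlgebra.ofPoly (hermiteR (k + t))

end

/-!
Write `A` for the first Weyl algebra, `G = ∂ - x`, `γ` for the standard Gaussian measure, and
`PSO` for the set of polynomial Stein operators.

*Stein operators.* Three sets are compared: the span of the `S(k,t)`, the right ideal `G A`, and
`PSO`. Since `G p = p ∂ - (X p - p')` for a polynomial `p`, and `H_{k+1} = X H_k - H_k'`, one has
`S(k,t+1) = G H_k ∂^t + S(k+1,t)` (`steinS_succ`); so the span lies in `G A`. Every smooth function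
of temperate growth is `γ`-integrable, this class contains all four test classes and is stable under
`A`, and `∫ (g' - t g) dγ = 0` by integration by parts; so `G A ⊆ PSO` (`steinG_mul_mem_PSO`).
Finally `H_k ∂^t = S(k,t) + H_{k+t}`, and the Hermite polynomials span all polynomials, so that
every operator is a polynomial modulo the span of the `S(k,t)`
(`exists_sub_ofPoly_mem_steinSpan`). A polynomial `p` in `PSO` vanishes: test it against `p`, or
against `p` times a bump function. Hence the three sets are equal. The `S(k,t)` are linearly
independent because of the uniqueness of the normal form `∑ p_t ∂^t`, which follows from the
action of `A` on polynomials.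

*Maximality.* A right ideal strictly above `G A` contains a polynomial `p ≠ 0`. The identity
`p G = G p - p'` then puts all the derivatives of `p` into it, among them a nonzero constant.

*Bernstein dimension.* If `Γ` is a good filtration, then `Γ_ν` is generated by some fixed `Γ_k`
under the Bernstein filtration (`WeylFiltration.IsGood.exists_Γ_le_generated`). As `Γ_k` is
finite-dimensional, `Γ_ν ⊆ Γ'_{ν+c}` for any other filtration `Γ'`, so that the degree of
`dim Γ_ν` is the same for all good filtrations (`WeylFiltration.HasDegree.unique`). For a cyclic
module `m A` the filtration `m 𝓕_ν` is good, and both modules in question are cyclic. Left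
multiplication by `G` is injective on `A`, so `dim G 𝓕_ν = dim 𝓕_ν = (ν + 1)(ν + 2) / 2`; and the
image of `𝓕_ν` in `A / G A` is that of the polynomials of degree at most `ν`, which has dimension
`ν + 1`.
-/

noncomputable section

namespace WeylAlgebra

section CommRing

/-! ### Commutation relations -/

variable {K : Type*} [CommRing K]

theorem ofPoly_X_mul (p : K[X]) : ofPoly (X * p) = x K * ofPoly p := by
  simp [ofPoly]

theorem ofPoly_X_pow (n : ℕ) : ofPoly (X ^ n : K[X]) = x K ^ n := by
  simp [ofPoly]

theorem ofPoly_mul (p q : K[X]) : ofPoly (p * q) = ofPoly p * ofPoly q := by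
  simp [ofPoly]

theorem d_mul_x_pow (n : ℕ) :
    d K * x K ^ n = x K ^ n * d K + (n : WeylAlgebra K) * x K ^ (n - 1) := by
  induction n with
  | zero => simp
  | succ n ih =>
    have h : (n : WeylAlgebra K) * x K ^ (n - 1) * x K = n * x K ^ n := by
      cases n with
      | zero => simp
      | succ n => rw [mul_assoc, Nat.add_sub_cancel, ← pow_succ]
    rw [pow_succ, ← mul_assoc, ih, add_mul, mul_assoc, d_mul_x, h, Nat.add_sub_cancel, mul_add,
      mul_assoc]
    push_cast
    rw [add_mul, one_mul, mul_one, add_comm (n * x K ^ n : WeylAlgebra K), add_assoc]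

/-- The commutator of `∂` with a polynomial `p(x)` is `p'(x)`. -/
theorem d_mul_ofPoly (p : K[X]) : d K * ofPoly p = ofPoly p * d K + ofPoly (derivative p) := by
  induction p using Polynomial.induction_on' with
  | add p q hp hq =>
    simp only [ofPoly, map_add] at hp hq ⊢
    rw [mul_add, hp, hq, add_mul]
    abel
  | monomial n a =>
    simp only [ofPoly, derivative_monomial, aeval_monomial, map_mul, map_natCast]
    rw [← mul_assoc, ← Algebra.commutes, mul_assoc, d_mul_x_pow, mul_add, mul_assoc, mul_assoc]

theorem d_pow_mul_x (n : ℕ) :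
    d K ^ n * x K = x K * d K ^ n + (n : WeylAlgebra K) * d K ^ (n - 1) := by
  induction n with
  | zero => simp
  | succ n ih =>
    have h : d K * ((n : WeylAlgebra K) * d K ^ (n - 1)) = n * d K ^ n := by
      cases n with
      | zero => simp
      | succ n => rw [← mul_assoc, ← Nat.cast_comm, mul_assoc, Nat.add_sub_cancel, ← pow_succ']
    rw [pow_succ', mul_assoc, ih, mul_add, ← mul_assoc, d_mul_x, h, Nat.add_sub_cancel, add_mul,
      mul_assoc]
    push_cast
    rw [add_mul, one_mul, add_comm (n * d K ^ n : WeylAlgebra K), add_assoc]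

/-! ### The Bernstein filtration -/

theorem monomial_mem_bernstein {α β ν : ℕ} (h : α + β ≤ ν) :
    x K ^ α * d K ^ β ∈ bernstein K ν :=
  Submodule.subset_span ⟨α, β, h, rfl⟩

theorem bernstein_mono : Monotone (bernstein K) := fun _ _ h =>
  Submodule.span_mono fun _ ⟨α, β, hab, hw⟩ => ⟨α, β, hab.trans h, hw⟩

theorem one_mem_bernstein (ν : ℕ) : (1 : WeylAlgebra K) ∈ bernstein K ν := by
  simpa using monomial_mem_bernstein (K := K) (α := 0) (β := 0) (ν := ν) (by omega)

theorem mul_x_mem_bernstein {ν : ℕ} {w : WeylAlgebra K} (hw : w ∈ bernstein K ν) :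
    w * x K ∈ bernstein K (ν + 1) := by
  refine Submodule.span_induction ?_ ?_ ?_ ?_ hw
  · rintro _ ⟨α, β, h, rfl⟩
    rw [mul_assoc, d_pow_mul_x, mul_add, ← mul_assoc, ← pow_succ, ← mul_assoc, ← Nat.cast_comm,
      mul_assoc, ← nsmul_eq_mul]
    exact add_mem (monomial_mem_bernstein (by omega))
      (nsmul_mem (monomial_mem_bernstein (by omega)) _)
  · simp
  · intro a b _ _ ha hb
    rw [add_mul]
    exact add_mem ha hb
  · intro c a _ ha
    rw [smul_mul_assoc]
    exact Submodule.smul_mem _ c ha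

theorem mul_d_mem_bernstein {ν : ℕ} {w : WeylAlgebra K} (hw : w ∈ bernstein K ν) :
    w * d K ∈ bernstein K (ν + 1) := by
  refine Submodule.span_induction ?_ ?_ ?_ ?_ hw
  · rintro _ ⟨α, β, h, rfl⟩
    rw [mul_assoc, ← pow_succ]
    exact monomial_mem_bernstein (by omega)
  · simp
  · intro a b _ _ ha hb
    rw [add_mul]
    exact add_mem ha hb
  · intro c a _ ha
    rw [smul_mul_assoc]
    exact Submodule.smul_mem _ c ha

theorem mul_mem_bernstein {m n : ℕ} {v w : WeylAlgebra K} (hv : v ∈ bernstein K m)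
    (hw : w ∈ bernstein K n) : v * w ∈ bernstein K (m + n) := by
  refine Submodule.span_induction ?_ ?_ ?_ ?_ hw
  · rintro _ ⟨α, β, h, rfl⟩
    have hx : ∀ α, v * x K ^ α ∈ bernstein K (m + α) := by
      intro α
      induction α with
      | zero => simpa using hv
      | succ α ih =>
        rw [pow_succ, ← mul_assoc]
        exact mul_x_mem_bernstein ih
    have hd : ∀ β, v * (x K ^ α * d K ^ β) ∈ bernstein K (m + α + β) := by
      intro β
      induction β with
      | zero => simpa using hx α
      | succ β ih =>
        rw [pow_succ, ← mul_assoc, ← mul_assoc, mul_assoc v]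
        exact mul_d_mem_bernstein ih
    exact bernstein_mono (by omega) (hd β)
  · simp
  · intro a b _ _ ha hb
    rw [mul_add]
    exact add_mem ha hb
  · intro c a _ ha
    rw [mul_smul_comm]
    exact Submodule.smul_mem _ c ha

theorem exists_mem_bernstein (w : WeylAlgebra K) : ∃ ν, w ∈ bernstein K ν := by
  obtain ⟨a, rfl⟩ : ∃ a, RingQuot.mkAlgHom K (WeylAlgebra.Rel K) a = w :=
    RingQuot.mkAlgHom_surjective K (WeylAlgebra.Rel K) w
  induction a using FreeAlgebra.induction with
  | grade0 r =>
    refine ⟨0, ?_⟩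
    rw [AlgHom.commutes, Algebra.algebraMap_eq_smul_one]
    exact Submodule.smul_mem _ r (one_mem_bernstein 0)
  | grade1 i =>
    refine ⟨1, ?_⟩
    cases i with
    | false => simpa using! monomial_mem_bernstein (K := K) (α := 1) (β := 0) (ν := 1) (by omega)
    | true => simpa using! monomial_mem_bernstein (K := K) (α := 0) (β := 1) (ν := 1) (by omega)
  | mul a b ha hb =>
    obtain ⟨m, hm⟩ := ha
    obtain ⟨n, hn⟩ := hb
    refine ⟨m + n, ?_⟩
    rw [map_mul]
    exact mul_mem_bernstein hm hn
  | add a b ha hb =>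
    obtain ⟨m, hm⟩ := ha
    obtain ⟨n, hn⟩ := hb
    refine ⟨max m n, ?_⟩
    rw [map_add]
    exact add_mem (bernstein_mono (le_max_left m n) hm) (bernstein_mono (le_max_right m n) hn)

/-- Every element of `A₁(K)` is a sum of terms `p(x) ∂^t`. -/
theorem ofPoly_mul_d_pow_induction {P : WeylAlgebra K → Prop}
    (mul : ∀ (p : K[X]) (t : ℕ), P (ofPoly p * d K ^ t))
    (add : ∀ v w, P v → P w → P (v + w)) (w : WeylAlgebra K) : P w := by
  obtain ⟨ν, hν⟩ := exists_mem_bernstein w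
  suffices h : ∀ c : K, P (c • w) by simpa using h 1
  refine Submodule.span_induction ?_ ?_ ?_ ?_ hν
  · rintro _ ⟨α, β, -, rfl⟩ c
    rw [← ofPoly_X_pow, ← smul_mul_assoc, ofPoly, ← map_smul]
    exact mul _ β
  · intro c
    simpa [ofPoly] using mul 0 0
  · intro a b _ _ ha hb c
    rw [smul_add]
    exact add _ _ (ha c) (hb c)
  · intro c a _ ha c'
    rw [smul_smul]
    exact ha _

/-! ### The action on polynomials and the normal form -/

/-- The action of `A₁(K)` on `K[X]` by differential operators. -/
def polyAct (K : Type*) [CommRing K] : WeylAlgebra K →ₐ[K] Module.End K K[X] :=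
  lift (LinearMap.mulLeft K X) derivative (by
    refine LinearMap.ext fun q => ?_
    simp [add_comm])

theorem polyAct_x (q : K[X]) : polyAct K (x K) q = X * q := by
  rw [polyAct, lift_x, LinearMap.mulLeft_apply]

theorem polyAct_d (q : K[X]) : polyAct K (d K) q = derivative q := by
  rw [polyAct, lift_d]

theorem polyAct_d_pow (t : ℕ) (q : K[X]) : polyAct K (d K ^ t) q = derivative^[t] q := by
  induction t with
  | zero => simp
  | succ t ih => rw [pow_succ', map_mul, Module.End.mul_apply, ih, polyAct_d,
      Function.iterate_succ_apply']

theorem polyAct_ofPoly (p q : K[X]) : polyAct K (ofPoly p) q = p * q := by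
  induction p using Polynomial.induction_on' with
  | add p₁ p₂ h₁ h₂ =>
    simp only [ofPoly, map_add, LinearMap.add_apply] at h₁ h₂ ⊢
    rw [h₁, h₂, add_mul]
  | monomial n a =>
    have h : ∀ n, polyAct K (x K ^ n) q = X ^ n * q := by
      intro n
      induction n with
      | zero => simp
      | succ n ih => rw [pow_succ', map_mul, Module.End.mul_apply, ih, polyAct_x, pow_succ',
          mul_assoc]
    rw [ofPoly, aeval_monomial, map_mul, AlgHom.commutes, Module.End.mul_apply, h,
      Module.algebraMap_end_apply, ← C_mul_X_pow_eq_monomial, mul_assoc, smul_eq_C_mul]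

/-- The linear map sending a finitely supported family of polynomials `p_t` to the
operator `∑ p_t(x) ∂^t`. -/
def normalForm (K : Type*) [CommRing K] : (ℕ →₀ K[X]) →ₗ[K] WeylAlgebra K :=
  Finsupp.lsum K fun t => LinearMap.mulRight K (d K ^ t) ∘ₗ (aeval (x K)).toLinearMap

theorem normalForm_single (t : ℕ) (p : K[X]) :
    normalForm K (Finsupp.single t p) = ofPoly p * d K ^ t := by
  simp [normalForm, ofPoly]

theorem normalForm_surjective : Function.Surjective (normalForm K) := by
  intro w
  induction w using ofPoly_mul_d_pow_induction with
  | mul p t => exact ⟨_, normalForm_single t p⟩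
  | add v w hv hw =>
    obtain ⟨f, rfl⟩ := hv
    obtain ⟨g, rfl⟩ := hw
    exact ⟨f + g, map_add _ f g⟩

end CommRing

section Field

variable {K : Type*} [Field K] [CharZero K]

/-- If `t` is the least index with `p_t ≠ 0`, then `∑ p_s ∂^s` sends `X^t` to `t! p_t`, since
`∂^s` kills `X^t` for `s > t`. -/
theorem eq_zero_of_polyAct_normalForm (f : ℕ →₀ K[X])
    (h : ∀ q, polyAct K (normalForm K f) q = 0) : f = 0 := by
  ext1 t
  induction t using Nat.strong_induction_on with
  | _ t ih =>
    have ht := h (X ^ t)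
    rw [normalForm, Finsupp.lsum_apply, Finsupp.sum, map_sum, LinearMap.sum_apply,
      Finset.sum_eq_single t] at ht
    · change polyAct K (ofPoly (f t) * d K ^ t) (X ^ t) = 0 at ht
      rw [map_mul, Module.End.mul_apply, polyAct_d_pow, polyAct_ofPoly,
        iterate_derivative_X_pow_eq_smul] at ht
      simpa [Nat.factorial_ne_zero] using ht
    · intro s _ hs
      change polyAct K (ofPoly (f s) * d K ^ s) (X ^ t) = 0
      rw [map_mul, Module.End.mul_apply, polyAct_d_pow, polyAct_ofPoly]
      rcases lt_or_gt_of_ne hs with hs | hs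
      · rw [ih s hs]
        simp
      · rw [iterate_derivative_eq_zero (by simpa using hs), mul_zero]
    · intro hs
      rw [Finsupp.notMem_support_iff.mp hs]
      simp

theorem normalForm_injective : Function.Injective (normalForm K) := by
  rw [injective_iff_map_eq_zero]
  intro f hf
  exact eq_zero_of_polyAct_normalForm f fun q => by simp [hf]

/-- `A₁(K)` acts faithfully on polynomials. -/
theorem eq_zero_of_polyAct_eq_zero {w : WeylAlgebra K} (h : ∀ q, polyAct K w q = 0) : w = 0 := by
  obtain ⟨f, rfl⟩ := normalForm_surjective w
  rw [eq_zero_of_polyAct_normalForm f h, map_zero]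

theorem linearIndependent_ofPoly_mul_d_pow {ι : Type*} {b : ι → K[X]}
    (hb : LinearIndependent K b) :
    LinearIndependent K fun p : Σ _ : ℕ, ι => ofPoly (b p.2) * d K ^ p.1 := by
  have h := (Finsupp.linearIndependent_single (R := K) (fun _ : ℕ => b) fun _ => hb).map_injOn
    (normalForm K) normalForm_injective.injOn
  convert h with p
  exact (normalForm_single _ _).symm

theorem linearIndependent_monomials :
    LinearIndependent K fun p : ℕ × ℕ => x K ^ p.1 * d K ^ p.2 := by
  have h := (linearIndependent_ofPoly_mul_d_pow (basisMonomials K).linearIndependent).comp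
    (fun p : ℕ × ℕ => (⟨p.2, p.1⟩ : Σ _ : ℕ, ℕ)) (by
      rintro ⟨a, b⟩ ⟨a', b'⟩ h
      simp_all)
  convert h with p
  simp [← X_pow_eq_monomial, ofPoly_X_pow]

end Field

section Finrank

/-! ### Dimension of the Bernstein filtration -/

variable (K : Type*) [Field K]

/-- The exponents `(α, β)` with `α + β ≤ ν`. -/
def bernsteinIndex (ν : ℕ) : Finset (ℕ × ℕ) :=
  (Finset.range (ν + 1)).biUnion Finset.HasAntidiagonal.antidiagonal

theorem mem_bernsteinIndex {ν : ℕ} {p : ℕ × ℕ} : p ∈ bernsteinIndex ν ↔ p.1 + p.2 ≤ ν := by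
  simp [bernsteinIndex]

theorem card_bernsteinIndex (ν : ℕ) :
    ((bernsteinIndex ν).card : ℚ) = 1 / 2 * ((ν + 1) * (ν + 2)) := by
  rw [bernsteinIndex, Finset.card_biUnion]
  · simp only [Finset.Nat.card_antidiagonal]
    induction ν with
    | zero => norm_num
    | succ n ih =>
      rw [Finset.sum_range_succ]
      push_cast at ih ⊢
      rw [ih]
      ring
  · intro i _ j _ hij
    rw [Function.onFun, Finset.disjoint_left]
    intro p hp hp'
    rw [Finset.HasAntidiagonal.mem_antidiagonal] at hp hp'
    omega

theorem bernstein_eq_span_range (ν : ℕ) : bernstein K ν =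
    Submodule.span K (Set.range fun p : bernsteinIndex ν => x K ^ p.1.1 * d K ^ p.1.2) := by
  rw [bernstein]
  congr 1
  ext w
  constructor
  · rintro ⟨α, β, h, rfl⟩
    exact ⟨⟨(α, β), mem_bernsteinIndex.mpr h⟩, rfl⟩
  · rintro ⟨p, rfl⟩
    exact ⟨p.1.1, p.1.2, mem_bernsteinIndex.mp p.2, rfl⟩

instance finite_bernstein (ν : ℕ) : Module.Finite K (bernstein K ν) := by
  rw [bernstein_eq_span_range]
  exact Module.Finite.span_of_finite K (Set.finite_range _)

theorem finrank_bernstein [CharZero K] (ν : ℕ) :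
    (Module.finrank K (bernstein K ν) : ℚ) = 1 / 2 * ((ν + 1) * (ν + 2)) := by
  rw [bernstein_eq_span_range, finrank_span_eq_card, Fintype.card_coe, card_bernsteinIndex]
  exact linearIndependent_monomials.comp _ Subtype.val_injective

end Finrank

end WeylAlgebra

/-! ### Good filtrations -/

namespace WeylFiltration

variable {K : Type*} [Field K] {M : Type*} [AddCommGroup M]
    [Module (WeylAlgebra K)ᵐᵒᵖ M] [Module K M]

/-- The part `∑_{i ≤ k, i + j ≤ ν} Γ_i · 𝓕_j` of `Γ_ν` that is generated in degrees at
most `k`. -/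
def generated (F : WeylFiltration K M) (k ν : ℕ) : Submodule K M :=
  Submodule.span K {m | ∃ i ≤ k, ∃ j, i + j ≤ ν ∧ ∃ y ∈ F.Γ i,
    ∃ a ∈ WeylAlgebra.bernstein K j, m = op a • y}

theorem generated_mono (F : WeylFiltration K M) (k : ℕ) : Monotone (F.generated k) :=
  fun _ _ h => Submodule.span_mono fun _ ⟨i, hi, j, hij, hm⟩ => ⟨i, hi, j, hij.trans h, hm⟩

theorem le_generated (F : WeylFiltration K M) {k ν : ℕ} (h : ν ≤ k) :
    F.Γ ν ≤ F.generated k ν := fun m hm =>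
  Submodule.subset_span ⟨ν, h, 0, le_rfl, m, hm, 1, WeylAlgebra.one_mem_bernstein 0, by simp⟩

theorem generated_le_of_le (F F' : WeylFiltration K M) {k c : ℕ} (h : F.Γ k ≤ F'.Γ c) (ν : ℕ) :
    F.generated k ν ≤ F'.Γ (ν + c) := by
  refine Submodule.span_le.mpr ?_
  rintro _ ⟨i, hi, j, hij, y, hy, a, ha, rfl⟩
  exact F'.mono (by omega) (F'.smul_mem j c a ha y (h (F.mono hi hy)))

theorem exists_le_Γ (F : WeylFiltration K M) (V : Submodule K M) [Module.Finite K V] :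
    ∃ c, V ≤ F.Γ c := by
  have hV : V.FG := Module.Finite.iff_fg.mp inferInstance
  obtain ⟨s, rfl⟩ := hV
  choose c hc using F.exhaustive
  exact ⟨s.sup c, Submodule.span_le.mpr fun m hm => F.mono (Finset.le_sup hm) (hc m)⟩

/-- The homogeneous subspace of `gr_Γ M` formed by the classes of the elements generated in
degrees at most `k`. -/
def grGenerated (F : WeylFiltration K M) (k : ℕ) : Submodule K F.Gr :=
  ⨅ ν, (((F.generated k ν).submoduleOf (F.Γ ν)).map (Submodule.mkQ _)).comap
    (DirectSum.component K ℕ F.GrPiece ν)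

theorem mem_grGenerated {F : WeylFiltration K M} {k : ℕ} {z : F.Gr} :
    z ∈ F.grGenerated k ↔
      ∀ ν, ∃ m : F.Γ ν, (m : M) ∈ F.generated k ν ∧ Submodule.mkQ _ m = z ν := by
  simp only [grGenerated, Submodule.mem_iInf, Submodule.mem_comap, Submodule.mem_map]
  rfl

theorem lof_mem_grGenerated {F : WeylFiltration K M} {k ν : ℕ} {m : F.Γ ν}
    (hm : (m : M) ∈ F.generated k ν) :
    DirectSum.lof K ℕ F.GrPiece ν (Submodule.mkQ _ m) ∈ F.grGenerated k := by
  rw [mem_grGenerated]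
  intro ν'
  rw [DirectSum.lof_eq_of]
  rcases eq_or_ne ν ν' with rfl | h
  · exact ⟨m, hm, by rw [DirectSum.of_eq_same]⟩
  · exact ⟨0, zero_mem _, by rw [map_zero, DirectSum.of_eq_of_ne _ _ _ h.symm]⟩

variable [IsScalarTower K (WeylAlgebra K)ᵐᵒᵖ M]

theorem smul_mem_generated (F : WeylFiltration K M) {k ν l : ℕ} {a : WeylAlgebra K}
    (ha : a ∈ WeylAlgebra.bernstein K l) {m : M} (hm : m ∈ F.generated k ν) :
    op a • m ∈ F.generated k (ν + l) := by
  suffices h : F.generated k ν ≤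
      (F.generated k (ν + l)).comap (Algebra.lsmul K K M (op a)) from h hm
  refine Submodule.span_le.mpr ?_
  rintro _ ⟨i, hi, j, hij, y, hy, b, hb, rfl⟩
  refine Submodule.subset_span ⟨i, hi, j + l, by omega, y, hy, b * a,
    WeylAlgebra.mul_mem_bernstein hb ha, ?_⟩
  change op a • op b • y = _
  rw [smul_smul, op_mul]

theorem grAct_of (F : WeylFiltration K M) (k : ℕ) (a : WeylAlgebra.bernstein K k) (ν : ℕ)
    (m : F.Γ ν) :
    F.grAct k a (DirectSum.lof K ℕ F.GrPiece ν (Submodule.mkQ _ m)) =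
      DirectSum.lof K ℕ F.GrPiece (ν + k) (Submodule.mkQ _ (F.actΓ k a ν m)) := by
  rw [grAct, DirectSum.toModule_lof]
  rfl

theorem grAct_mem_grGenerated (F : WeylFiltration K M) (k l : ℕ)
    (a : WeylAlgebra.bernstein K l) {z : F.Gr} (hz : z ∈ F.grGenerated k) :
    F.grAct l a z ∈ F.grGenerated k := by
  classical
  rw [← DirectSum.sum_support_of z, map_sum]
  refine sum_mem fun ν _ => ?_
  obtain ⟨m, hm, hmz⟩ := mem_grGenerated.mp hz ν
  rw [← hmz, ← DirectSum.lof_eq_of K, grAct_of]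
  exact lof_mem_grGenerated (F.smul_mem_generated a.2 hm)

/-- A good filtration is generated in bounded degrees. If the homogeneous components of a finite
generating set of `gr_Γ M` live in degrees `≤ k`, the subspace `grGenerated k` contains this set
and is stable, hence is everything; then `Γ_ν ⊆ generated k ν + Γ_{ν-1}` and induction on `ν`
applies. -/
theorem IsGood.exists_Γ_le_generated {F : WeylFiltration K M} (hF : F.IsGood) :
    ∃ k, ∀ ν, F.Γ ν ≤ F.generated k ν := by
  classical
  obtain ⟨s, hs⟩ := hF
  let k : ℕ := s.sup fun z => (DFinsupp.support z).sup id
  have htop : F.grGenerated k = ⊤ := by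
    refine hs _ (fun z hz => mem_grGenerated.mpr fun ν => ?_)
      fun l a z hz => F.grAct_mem_grGenerated k l a hz
    by_cases h : ν ≤ k
    · obtain ⟨m, hm⟩ := Submodule.mkQ_surjective _ (z ν)
      exact ⟨m, F.le_generated h m.2, hm⟩
    · refine ⟨0, zero_mem _, ?_⟩
      rw [map_zero]
      by_contra hne
      have h₁ : ν ≤ (DFinsupp.support z).sup id :=
        Finset.le_sup (f := id) (DFinsupp.mem_support_toFun z ν |>.mpr (Ne.symm hne))
      exact h (h₁.trans (Finset.le_sup (f := fun z : F.Gr => (DFinsupp.support z).sup id) hz))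
  refine ⟨k, fun ν m hm => ?_⟩
  induction ν generalizing m with
  | zero => exact F.le_generated (Nat.zero_le k) hm
  | succ n ih =>
    have hmem : DirectSum.lof K ℕ F.GrPiece (n + 1) (Submodule.mkQ _ ⟨m, hm⟩) ∈
        F.grGenerated k := htop ▸ Submodule.mem_top
    obtain ⟨w, hw, hwm⟩ := mem_grGenerated.mp hmem (n + 1)
    rw [DirectSum.lof_eq_of, DirectSum.of_eq_same] at hwm
    have hsub := (Submodule.Quotient.eq _).mp hwm
    change (w : M) - m ∈ F.Γ n at hsub
    have h := sub_mem hw (F.generated_mono k n.le_succ (ih _ hsub))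
    rwa [sub_sub_cancel] at h

/-- A good filtration grows, up to a shift, no faster than any other filtration. -/
theorem IsGood.exists_le_shift {F : WeylFiltration K M} (hF : F.IsGood)
    (F' : WeylFiltration K M) : ∃ c, ∀ ν, F.Γ ν ≤ F'.Γ (ν + c) := by
  obtain ⟨k, hk⟩ := hF.exists_Γ_le_generated
  have := F.finite k
  obtain ⟨c, hc⟩ := F'.exists_le_Γ (F.Γ k)
  exact ⟨c, fun ν => (hk ν).trans (F.generated_le_of_le F' hc ν)⟩

/-- If `p` had the larger degree, `q(ν + c) / p(ν)` would tend to `0`. -/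
theorem natDegree_le_of_eventually_le {p q : ℚ[X]} {c : ℕ}
    (hp : ∀ᶠ ν : ℕ in Filter.atTop, 0 ≤ p.eval (ν : ℚ))
    (h : ∀ᶠ ν : ℕ in Filter.atTop, p.eval (ν : ℚ) ≤ q.eval ((ν + c : ℕ) : ℚ)) :
    p.natDegree ≤ q.natDegree := by
  by_contra! hlt
  have hq : (q.comp (X + C (c : ℚ))).natDegree = q.natDegree := by
    rw [natDegree_comp, natDegree_X_add_C, mul_one]
  have hp0 : p ≠ 0 := by
    rintro rfl
    simp at hlt
  have hdeg : (q.comp (X + C (c : ℚ))).degree < p.degree := by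
    apply degree_lt_degree
    rwa [hq]
  have hlim := (Polynomial.div_tendsto_atTop_zero_of_degree_lt _ _ hdeg).comp
    (tendsto_natCast_atTop_atTop (R := ℚ))
  have hne : ∀ᶠ ν : ℕ in Filter.atTop, p.eval (ν : ℚ) ≠ 0 :=
    (tendsto_natCast_atTop_atTop (R := ℚ)).eventually
      ((Polynomial.eventually_atTop_not_isRoot p hp0))
  obtain ⟨ν, h₁, h₂, h₃, h₄⟩ :=
    (hp.and (h.and (hne.and (hlim.eventually_lt_const one_pos)))).exists
  have hpos : 0 < p.eval (ν : ℚ) := lt_of_le_of_ne h₁ h₃.symm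
  simp only [Function.comp_apply] at h₄
  rw [div_lt_one hpos] at h₄
  simp only [eval_comp, eval_add, eval_X, eval_C] at h₄
  push_cast at h₂
  linarith

/-- Two good filtrations of a module have the same degree of growth. -/
theorem HasDegree.unique {F F' : WeylFiltration K M} (hF : F.IsGood) (hF' : F'.IsGood)
    {e e' : ℕ} (he : F.HasDegree e) (he' : F'.HasDegree e') : e' = e := by
  have key : ∀ {F F' : WeylFiltration K M} {e e' : ℕ}, F.IsGood → F.HasDegree e →
      F'.HasDegree e' → e ≤ e' := by
    rintro F F' _ _ hF ⟨p, rfl, hp⟩ ⟨q, rfl, hq⟩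
    obtain ⟨c, hc⟩ := hF.exists_le_shift F'
    refine natDegree_le_of_eventually_le (c := c) ?_ ?_
    · filter_upwards [hp] with ν hν
      rw [← hν]
      positivity
    · filter_upwards [hp, (Filter.tendsto_add_atTop_nat c).eventually hq] with ν hν hν'
      have := F'.finite (ν + c)
      rw [← hν, ← hν']
      exact_mod_cast Submodule.finrank_mono (hc ν)
  exact le_antisymm (key hF' he' he) (key hF he he')

/-! ### Cyclic modules -/

/-- The map `a ↦ m · a` from `A₁(K)` to a right module. -/
def orbitMap (K : Type*) [Field K] {M : Type*} [AddCommGroup M] [Module (WeylAlgebra K)ᵐᵒᵖ M]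
    [Module K M] [IsScalarTower K (WeylAlgebra K)ᵐᵒᵖ M] (m : M) : WeylAlgebra K →ₗ[K] M where
  toFun a := op a • m
  map_add' a b := by rw [op_add, add_smul]
  map_smul' c a := by rw [op_smul, smul_assoc, RingHom.id_apply]

/-- The filtration `Γ_ν = m · 𝓕_ν` of the cyclic module generated by `m`. -/
def cyclic (K : Type*) [Field K] {M : Type*} [AddCommGroup M] [Module (WeylAlgebra K)ᵐᵒᵖ M]
    [Module K M] [IsScalarTower K (WeylAlgebra K)ᵐᵒᵖ M] (m : M)
    (hm : ∀ y : M, ∃ a : WeylAlgebra K, op a • m = y) : WeylFiltration K M where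
  Γ ν := (WeylAlgebra.bernstein K ν).map (orbitMap K m)
  mono _ _ h := Submodule.map_mono (WeylAlgebra.bernstein_mono h)
  finite ν := inferInstance
  exhaustive y := by
    obtain ⟨a, rfl⟩ := hm y
    obtain ⟨ν, hν⟩ := WeylAlgebra.exists_mem_bernstein a
    exact ⟨ν, a, hν, rfl⟩
  smul_mem k ν a ha y hy := by
    obtain ⟨b, hb, rfl⟩ := hy
    refine ⟨b * a, WeylAlgebra.mul_mem_bernstein hb ha, ?_⟩
    exact mul_smul (op a) (op b) m

/-- The class of `m` in degree `0` generates the associated graded module. -/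
theorem isGood_cyclic (m : M) (hm : ∀ y : M, ∃ a : WeylAlgebra K, op a • m = y) :
    (cyclic K m hm).IsGood := by
  classical
  set F := cyclic K m hm with hF
  have hm0 : m ∈ F.Γ 0 := ⟨1, WeylAlgebra.one_mem_bernstein 0, one_smul _ m⟩
  refine ⟨{DirectSum.lof K ℕ F.GrPiece 0 (Submodule.mkQ _ ⟨m, hm0⟩)}, fun N hN hact => ?_⟩
  rw [Finset.coe_singleton, Set.singleton_subset_iff] at hN
  -- The action of `𝓕_ν` on degree `0` lands in the piece of index `0 + ν`, which is not
  -- definitionally `ν`.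
  have key : ∀ n ν, n = 0 + ν → ∀ y : F.GrPiece n, DirectSum.lof K ℕ F.GrPiece n y ∈ N := by
    rintro _ ν rfl y
    obtain ⟨⟨y, hy⟩, rfl⟩ := Submodule.mkQ_surjective _ y
    obtain ⟨a, ha, hay⟩ := hy
    have ha' : a ∈ WeylAlgebra.bernstein K ν := by simpa using ha
    have h := hact ν ⟨a, ha'⟩ _ hN
    rw [grAct_of] at h
    convert h using 4
    exact Subtype.ext hay.symm
  rw [eq_top_iff]
  intro z _
  rw [← DirectSum.sum_support_of z]
  refine sum_mem fun ν _ => ?_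
  rw [← DirectSum.lof_eq_of K]
  exact key ν ν (zero_add ν).symm _

/-- A cyclic module whose filtration `m · 𝓕_ν` has polynomial dimension of degree `e` has
Bernstein dimension `e`. -/
theorem hasBernsteinDim_of_cyclic (m : M) (hm : ∀ y : M, ∃ a : WeylAlgebra K, op a • m = y)
    {e : ℕ} (he : (cyclic K m hm).HasDegree e) : HasBernsteinDim K M e := by
  refine ⟨⟨⟨{m}, ?_⟩⟩, ⟨_, isGood_cyclic m hm, he⟩, fun F hF e' he' =>
    he.unique (isGood_cyclic m hm) hF he'⟩
  rw [eq_top_iff]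
  intro y _
  obtain ⟨a, rfl⟩ := hm y
  exact Submodule.smul_mem _ _ (Submodule.subset_span (by simp))

end WeylFiltration

theorem HasBernsteinDim.unique {K : Type*} [Field K] {M : Type*} [AddCommGroup M]
    [Module (WeylAlgebra K)ᵐᵒᵖ M] [Module K M] [IsScalarTower K (WeylAlgebra K)ᵐᵒᵖ M]
    {e e' : ℕ} (h : HasBernsteinDim K M e) (h' : HasBernsteinDim K M e') : e = e' := by
  obtain ⟨F, hF, he⟩ := h.2.1
  exact h'.2.2 F hF e he

/-! ### Gaussian integration by parts -/

theorem hasDerivAt_gaussianPDFReal_zero_one (t : ℝ) :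
    HasDerivAt (gaussianPDFReal 0 1) (-t * gaussianPDFReal 0 1 t) t := by
  have h : HasDerivAt (fun t : ℝ => (√(2 * Real.pi * (1 : NNReal)))⁻¹ *
      Real.exp (-(t - 0) ^ 2 / (2 * (1 : NNReal)))) _ t :=
    (((((hasDerivAt_id t).sub_const 0).pow 2).neg.div_const _).exp.const_mul _)
  rw [gaussianPDFReal_def]
  convert h using 1
  simp
  ring

theorem integrable_gaussianReal_iff {f : ℝ → ℝ} :
    Integrable f (gaussianReal 0 1) ↔ Integrable fun t => gaussianPDFReal 0 1 t * f t := by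
  rw [gaussianReal_of_var_ne_zero _ one_ne_zero,
    integrable_withDensity_iff_integrable_smul' (measurable_gaussianPDF 0 1)
      (Filter.Eventually.of_forall fun _ => gaussianPDF_lt_top)]
  simp only [toReal_gaussianPDF, smul_eq_mul]

/-- Stein's identity `E[g'(N) - N g(N)] = 0`: with the Gaussian density `φ`, one has
`(g' - t g) φ = (g φ)'`. -/
theorem integral_deriv_sub_mul_gaussianReal {g g' : ℝ → ℝ} (hg : ∀ t, HasDerivAt g (g' t) t)
    (hi : Integrable g (gaussianReal 0 1))
    (hi' : Integrable (fun t => g' t - t * g t) (gaussianReal 0 1)) :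
    ∫ t, (g' t - t * g t) ∂(gaussianReal 0 1) = 0 := by
  rw [integral_gaussianReal_eq_integral_smul one_ne_zero]
  simp only [smul_eq_mul]
  refine integral_eq_zero_of_hasDerivAt_of_integrable (fun t => ?_)
    (integrable_gaussianReal_iff.mp hi') (integrable_gaussianReal_iff.mp hi)
  refine ((hasDerivAt_gaussianPDFReal_zero_one t).mul (hg t)).congr_deriv ?_
  ring

/-- The Gaussian measure has moments of all orders. -/
theorem Function.HasTemperateGrowth.integrable_gaussianReal {f : ℝ → ℝ}
    (hf : f.HasTemperateGrowth) : Integrable f (gaussianReal 0 1) := by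
  obtain ⟨k, C, h⟩ := hf.2 0
  have hm : MemLp (fun t : ℝ => 1 + ‖t‖) k (gaussianReal 0 1) :=
    (memLp_const (1 : ℝ)).add (memLp_id_gaussianReal' k (ENNReal.natCast_ne_top k)).norm
  have hi : Integrable (fun t : ℝ => C * ‖1 + ‖t‖‖ ^ k) (gaussianReal 0 1) :=
    hm.integrable_norm_pow'.const_mul C
  refine hi.mono' hf.1.continuous.aestronglyMeasurable (Filter.Eventually.of_forall fun t => ?_)
  have ht := h t
  rw [norm_iteratedFDeriv_zero] at ht
  rwa [Real.norm_of_nonneg (by positivity : (0 : ℝ) ≤ 1 + ‖t‖)]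

/-! ### The test classes -/

theorem hasTemperateGrowth_deriv {f : ℝ → ℝ} (hf : f.HasTemperateGrowth) :
    (deriv f).HasTemperateGrowth := by
  refine ⟨(contDiff_infty_iff_deriv.mp hf.1).2, fun n => ?_⟩
  obtain ⟨k, C, h⟩ := hf.2 (n + 1)
  refine ⟨k, C, fun t => ?_⟩
  have := h t
  rwa [norm_iteratedFDeriv_eq_norm_iteratedDeriv, iteratedDeriv_succ',
    ← norm_iteratedFDeriv_eq_norm_iteratedDeriv] at this

theorem weylAct_mem_growthClass (S : WeylAlgebra ℝ) {f : smoothFun} (hf : f ∈ growthClass) :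
    weylAct S f ∈ growthClass := by
  have hx : ∀ g ∈ growthClass, weylAct (WeylAlgebra.x ℝ) g ∈ growthClass := by
    intro g hg
    rw [weylAct, WeylAlgebra.lift_x]
    exact Function.HasTemperateGrowth.mul Function.HasTemperateGrowth.id' hg
  have hd : ∀ g ∈ growthClass, weylAct (WeylAlgebra.d ℝ) g ∈ growthClass := by
    intro g hg
    rw [weylAct, WeylAlgebra.lift_d]
    exact hasTemperateGrowth_deriv hg
  have hadd : ∀ g ∈ growthClass, ∀ h ∈ growthClass, g + h ∈ growthClass := fun g hg h hh =>
    Function.HasTemperateGrowth.add hg hh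
  have hsmul : ∀ (c : ℝ), ∀ g ∈ growthClass, c • g ∈ growthClass := fun c g hg =>
    (Function.HasTemperateGrowth.const c).mul hg
  obtain ⟨ν, hν⟩ := WeylAlgebra.exists_mem_bernstein S
  refine Submodule.span_induction ?_ ?_ ?_ ?_ hν
  · rintro _ ⟨α, β, -, rfl⟩
    have hdp : ∀ β, weylAct (WeylAlgebra.d ℝ ^ β) f ∈ growthClass := by
      intro β
      induction β with
      | zero => simpa using hf
      | succ β ih =>
        rw [pow_succ', map_mul]
        exact hd _ ih
    induction α with
    | zero => simpa using hdp β
    | succ α ih =>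
      rw [pow_succ', mul_assoc, map_mul]
      exact hx _ ih
  · rw [map_zero]
    simpa using hsmul 0 f hf
  · intro a b _ _ ha hb
    rw [map_add]
    exact hadd _ ha _ hb
  · intro c a _ ha
    rw [map_smul]
    exact hsmul c _ ha

theorem compactClass_subset_schwartzClass : compactClass ⊆ schwartzClass := fun f hf =>
  ⟨HasCompactSupport.toSchwartzMap hf (smoothFun_contDiff f), rfl⟩

theorem schwartzClass_subset_growthClass : schwartzClass ⊆ growthClass := by
  rintro f ⟨g, hg⟩
  change Function.HasTemperateGrowth _
  rw [← hg]
  exact g.hasTemperateGrowth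

theorem Polynomial.hasTemperateGrowth (p : ℝ[X]) :
    Function.HasTemperateGrowth fun t => p.eval t := by
  induction p using Polynomial.induction_on' with
  | add p q hp hq =>
    simp only [eval_add]
    exact hp.add hq
  | monomial n a =>
    simp only [eval_monomial]
    fun_prop

theorem polyClass_subset_growthClass : polyClass ⊆ growthClass := by
  rintro f ⟨p, hp⟩
  change Function.HasTemperateGrowth _
  rw [hp]
  exact p.hasTemperateGrowth

theorem PSO_antitone {𝓕 𝓖 : Set smoothFun} (h : 𝓕 ⊆ 𝓖) (μ : Measure ℝ) : PSO 𝓖 μ ⊆ PSO 𝓕 μ :=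
  fun _ hS f hf => hS f (h hf)

theorem steinG_mul_mem_PSO (L : WeylAlgebra ℝ) :
    steinG * L ∈ PSO growthClass (gaussianReal 0 1) := by
  intro f hf
  have hg := weylAct_mem_growthClass L hf
  have hi : Integrable (weylAct (steinG * L) f : ℝ → ℝ) (gaussianReal 0 1) :=
    (weylAct_mem_growthClass _ hf).integrable_gaussianReal
  refine ⟨hi, ?_⟩
  have h : (weylAct (steinG * L) f : ℝ → ℝ) = fun t =>
      deriv (weylAct L f : ℝ → ℝ) t - t * (weylAct L f : ℝ → ℝ) t := by
    rw [steinG, map_mul, map_sub, weylAct, WeylAlgebra.lift_x, WeylAlgebra.lift_d]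
    rfl
  rw [h] at hi ⊢
  exact integral_deriv_sub_mul_gaussianReal
    (fun t => (smoothFun_differentiable _ t).hasDerivAt) hg.integrable_gaussianReal hi

theorem weylAct_ofPoly (p : ℝ[X]) (f : smoothFun) :
    (weylAct (WeylAlgebra.ofPoly p) f : ℝ → ℝ) = fun t => p.eval t * (f : ℝ → ℝ) t := by
  have hx : ∀ n, (weylAct (WeylAlgebra.x ℝ ^ n) f : ℝ → ℝ) = fun t => t ^ n * (f : ℝ → ℝ) t := by
    intro n
    induction n with
    | zero => simp
    | succ n ih =>
      ext t
      rw [pow_succ', map_mul, Module.End.mul_apply, weylAct, WeylAlgebra.lift_x]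
      change t * (weylAct (WeylAlgebra.x ℝ ^ n) f : ℝ → ℝ) t = _
      rw [ih, pow_succ', mul_assoc]
  induction p using Polynomial.induction_on' with
  | add p q hp hq =>
    ext t
    simp only [WeylAlgebra.ofPoly, map_add, LinearMap.add_apply, Submodule.coe_add, Pi.add_apply,
      eval_add] at hp hq ⊢
    rw [hp, hq, add_mul]
  | monomial n a =>
    ext t
    rw [WeylAlgebra.ofPoly, aeval_monomial, map_mul, AlgHom.commutes, Module.End.mul_apply,
      Module.algebraMap_end_apply, Submodule.coe_smul, Pi.smul_apply, hx, eval_monomial,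
      smul_eq_mul, mul_assoc]

/-- A polynomial `p` vanishes if `p² w` has Gaussian mean zero for a continuous weight `w ≥ 0`
which is positive near `0`. -/
theorem eq_zero_of_integral_sq_mul_eq_zero {p : ℝ[X]} {w : ℝ → ℝ} (hc : Continuous w)
    (hw : ∀ t, 0 ≤ w t) (hpos : ∀ᶠ t in nhds 0, 0 < w t)
    (hi : Integrable (fun t => p.eval t * (p.eval t * w t)) (gaussianReal 0 1))
    (h0 : ∫ t, p.eval t * (p.eval t * w t) ∂(gaussianReal 0 1) = 0) : p = 0 := by
  rw [integrable_gaussianReal_iff] at hi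
  rw [integral_gaussianReal_eq_integral_smul one_ne_zero] at h0
  simp only [smul_eq_mul] at h0
  have hφ : Continuous (gaussianPDFReal 0 1) :=
    continuous_iff_continuousAt.mpr fun t => (hasDerivAt_gaussianPDFReal_zero_one t).continuousAt
  have hnn : ∀ t, 0 ≤ gaussianPDFReal 0 1 t * (p.eval t * (p.eval t * w t)) := fun t => by
    rw [← mul_assoc (p.eval t)]
    exact mul_nonneg (gaussianPDFReal_nonneg 0 1 t) (mul_nonneg (mul_self_nonneg _) (hw t))
  have hz := (Continuous.ae_eq_iff_eq volume
    (hφ.mul (p.continuous.mul (p.continuous.mul hc))) continuous_zero).mp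
    ((integral_eq_zero_iff_of_nonneg hnn hi).mp h0)
  have hroot : ∀ᶠ t in nhds (0 : ℝ), p.IsRoot t := by
    filter_upwards [hpos] with t ht
    have h := congrFun hz t
    have hφt := (gaussianPDFReal_pos 0 1 t one_ne_zero).ne'
    simpa [hφt, ht.ne'] using h
  refine Polynomial.eq_zero_of_infinite_isRoot p ?_
  exact infinite_of_mem_nhds 0 hroot

theorem eq_zero_of_ofPoly_mem_PSO_polyClass {p : ℝ[X]}
    (hp : WeylAlgebra.ofPoly p ∈ PSO polyClass (gaussianReal 0 1)) : p = 0 := by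
  let f : smoothFun := ⟨fun t => p.eval t, p.contDiff_aeval ∞⟩
  obtain ⟨hi, h0⟩ := hp f ⟨p, rfl⟩
  rw [weylAct_ofPoly] at hi h0
  refine eq_zero_of_integral_sq_mul_eq_zero (w := fun _ => 1) continuous_const
    (fun _ => zero_le_one) (by simp) ?_ ?_
  · simpa only [mul_one] using hi
  · simpa only [mul_one] using h0

theorem eq_zero_of_ofPoly_mem_PSO_compactClass {p : ℝ[X]}
    (hp : WeylAlgebra.ofPoly p ∈ PSO compactClass (gaussianReal 0 1)) : p = 0 := by
  let b : ContDiffBump (0 : ℝ) := ⟨1, 2, one_pos, one_lt_two⟩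
  let f : smoothFun := ⟨fun t => p.eval t * b t, (p.contDiff_aeval ∞).mul b.contDiff⟩
  obtain ⟨hi, h0⟩ := hp f (b.hasCompactSupport.mul_left)
  rw [weylAct_ofPoly] at hi h0
  refine eq_zero_of_integral_sq_mul_eq_zero b.continuous (fun _ => b.nonneg) ?_ hi h0
  filter_upwards [b.eventuallyEq_one] with t ht
  rw [ht]
  exact one_pos

/-! ### Hermite polynomials and the right ideal generated by `G` -/

theorem hermiteR_succ (k : ℕ) : hermiteR (k + 1) = X * hermiteR k - derivative (hermiteR k) := by
  simp [hermiteR, hermite_succ, derivative_map]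

/-- The Hermite polynomials, as a sequence of polynomials of degrees `0, 1, 2, …`. -/
def hermiteSequence : Polynomial.Sequence ℝ where
  elems' := hermiteR
  degree_eq' k := by
    rw [hermiteR, (hermite_monic k).degree_map, degree_hermite]

theorem span_hermiteR : Submodule.span ℝ (Set.range hermiteR) = ⊤ :=
  hermiteSequence.span fun i => (leadingCoeff_ne_zero.mpr (hermiteSequence.ne_zero i)).isUnit

theorem linearIndependent_hermiteR : LinearIndependent ℝ hermiteR :=
  hermiteSequence.linearIndependent

theorem steinG_mul_ofPoly (p : ℝ[X]) : steinG * WeylAlgebra.ofPoly p =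
    WeylAlgebra.ofPoly p * WeylAlgebra.d ℝ - WeylAlgebra.ofPoly (X * p - derivative p) := by
  have h : WeylAlgebra.ofPoly (X * p - derivative p) =
      WeylAlgebra.x ℝ * WeylAlgebra.ofPoly p - WeylAlgebra.ofPoly (derivative p) := by
    rw [← WeylAlgebra.ofPoly_X_mul]
    simp only [WeylAlgebra.ofPoly, map_sub]
  rw [h, steinG, sub_mul, WeylAlgebra.d_mul_ofPoly]
  abel

theorem ofPoly_mul_steinG (p : ℝ[X]) : WeylAlgebra.ofPoly p * steinG =
    steinG * WeylAlgebra.ofPoly p - WeylAlgebra.ofPoly (derivative p) := by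
  have h : WeylAlgebra.ofPoly p * WeylAlgebra.x ℝ = WeylAlgebra.x ℝ * WeylAlgebra.ofPoly p := by
    rw [← WeylAlgebra.ofPoly_X_mul, mul_comm X, WeylAlgebra.ofPoly_mul]
    simp [WeylAlgebra.ofPoly]
  rw [steinG, sub_mul, mul_sub, WeylAlgebra.d_mul_ofPoly, h]
  abel

/-- `S(k,t)` telescopes: `S(k,t+1) - S(k+1,t) = G H_k ∂^t`. -/
theorem steinS_succ (k t : ℕ) : steinS k (t + 1) =
    steinG * (WeylAlgebra.ofPoly (hermiteR k) * WeylAlgebra.d ℝ ^ t) + steinS (k + 1) t := by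
  rw [steinS, steinS, ← mul_assoc, steinG_mul_ofPoly, ← hermiteR_succ, sub_mul, mul_assoc,
    ← pow_succ', add_right_comm k 1 t, ← add_assoc]
  abel

/-- The right ideal `G A₁`. -/
def steinIdeal : Submodule (WeylAlgebra ℝ)ᵐᵒᵖ (WeylAlgebra ℝ) :=
  Submodule.span (WeylAlgebra ℝ)ᵐᵒᵖ {steinG}

theorem mem_steinIdeal {S : WeylAlgebra ℝ} : S ∈ steinIdeal ↔ ∃ L, S = steinG * L := by
  rw [steinIdeal, Submodule.mem_span_singleton]
  constructor
  · rintro ⟨a, rfl⟩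
    exact ⟨a.unop, rfl⟩
  · rintro ⟨L, rfl⟩
    exact ⟨op L, rfl⟩

theorem steinG_mul_mem (L : WeylAlgebra ℝ) : steinG * L ∈ steinIdeal :=
  mem_steinIdeal.mpr ⟨L, rfl⟩

theorem smul_mem_steinIdeal (c : ℝ) {S : WeylAlgebra ℝ} (hS : S ∈ steinIdeal) :
    c • S ∈ steinIdeal := by
  obtain ⟨L, rfl⟩ := mem_steinIdeal.mp hS
  rw [← mul_smul_comm]
  exact steinG_mul_mem _

theorem steinS_mem_steinIdeal (k t : ℕ) : steinS k t ∈ steinIdeal := by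
  induction t generalizing k with
  | zero => simp [steinS]
  | succ t ih =>
    rw [steinS_succ]
    exact add_mem (steinG_mul_mem _) (ih _)

/-- The span of the operators `S(k,t)`, `t ≥ 1`. -/
def steinSpan : Submodule ℝ (WeylAlgebra ℝ) :=
  Submodule.span ℝ (Set.range fun p : {p : ℕ × ℕ // 1 ≤ p.2} => steinS p.1.1 p.1.2)

theorem steinSpan_subset_steinIdeal {S : WeylAlgebra ℝ} (hS : S ∈ steinSpan) :
    S ∈ steinIdeal := by
  refine Submodule.span_induction ?_ (zero_mem _) (fun _ _ _ _ => add_mem)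
    (fun c _ _ => smul_mem_steinIdeal c) hS
  rintro _ ⟨p, rfl⟩
  exact steinS_mem_steinIdeal _ _

/-- As `H_k ∂^t ≡ H_{k+t}` modulo the `S(k,t)`, every operator is congruent to a polynomial. -/
theorem exists_sub_ofPoly_mem_steinSpan (S : WeylAlgebra ℝ) :
    ∃ p : ℝ[X], S - WeylAlgebra.ofPoly p ∈ steinSpan := by
  have hadd : ∀ v w : WeylAlgebra ℝ, (∃ p : ℝ[X], v - WeylAlgebra.ofPoly p ∈ steinSpan) →
      (∃ p : ℝ[X], w - WeylAlgebra.ofPoly p ∈ steinSpan) →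
      ∃ p : ℝ[X], v + w - WeylAlgebra.ofPoly p ∈ steinSpan := by
    rintro v w ⟨p, hp⟩ ⟨q, hq⟩
    refine ⟨p + q, ?_⟩
    have h : v + w - WeylAlgebra.ofPoly (p + q) =
        (v - WeylAlgebra.ofPoly p) + (w - WeylAlgebra.ofPoly q) := by
      simp only [WeylAlgebra.ofPoly, map_add]
      abel
    rw [h]
    exact add_mem hp hq
  induction S using WeylAlgebra.ofPoly_mul_d_pow_induction with
  | add v w hv hw => exact hadd v w hv hw
  | mul p t =>
    have hp : p ∈ Submodule.span ℝ (Set.range hermiteR) := span_hermiteR ▸ Submodule.mem_top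
    induction hp using Submodule.span_induction with
    | mem q hq =>
      obtain ⟨k, rfl⟩ := hq
      refine ⟨hermiteR (k + t), ?_⟩
      rcases Nat.eq_zero_or_pos t with rfl | ht
      · simp
      · exact Submodule.subset_span ⟨⟨(k, t), ht⟩, rfl⟩
    | zero => exact ⟨0, by simp [WeylAlgebra.ofPoly]⟩
    | add p q _ _ hp hq =>
      have h := hadd _ _ hp hq
      rw [← add_mul] at h
      simpa only [WeylAlgebra.ofPoly, map_add] using h
    | smul c q _ hq =>
      obtain ⟨r, hr⟩ := hq
      refine ⟨c • r, ?_⟩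
      simp only [WeylAlgebra.ofPoly, map_smul, smul_mul_assoc, ← smul_sub] at hr ⊢
      exact Submodule.smul_mem _ c hr

/-- Dropping the term of order zero of the normal form sends `S(k,t)` to `H_k ∂^t`. -/
theorem linearIndependent_steinS :
    LinearIndependent ℝ fun p : {p : ℕ × ℕ // 1 ≤ p.2} => steinS p.1.1 p.1.2 := by
  let b : {p : ℕ × ℕ // 1 ≤ p.2} → (ℕ →₀ ℝ[X]) := fun p =>
    Finsupp.single p.1.2 (hermiteR p.1.1) - Finsupp.single 0 (hermiteR (p.1.1 + p.1.2))
  have hb : LinearIndependent ℝ b := by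
    refine LinearIndependent.of_comp
      (Finsupp.lcomapDomain Nat.succ Nat.succ_injective : (ℕ →₀ ℝ[X]) →ₗ[ℝ] ℕ →₀ ℝ[X]) ?_
    have h := (Finsupp.linearIndependent_single (R := ℝ) (fun _ : ℕ => hermiteR)
      fun _ => linearIndependent_hermiteR).comp
      (fun p : {p : ℕ × ℕ // 1 ≤ p.2} => (⟨p.1.2 - 1, p.1.1⟩ : Σ _ : ℕ, ℕ)) (by
        rintro ⟨⟨k, t⟩, ht⟩ ⟨⟨k', t'⟩, ht'⟩ h
        simp only [Sigma.mk.injEq, heq_eq_eq] at h ht ht'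
        simp only [Subtype.mk.injEq, Prod.mk.injEq]
        omega)
    convert h using 1
    funext ⟨⟨k, t⟩, ht⟩
    obtain ⟨t, rfl⟩ := Nat.exists_eq_add_of_le' ht
    ext1 s
    simp [b, Finsupp.lcomapDomain, Finsupp.single_apply]
  have h := hb.map_injOn (WeylAlgebra.normalForm ℝ) WeylAlgebra.normalForm_injective.injOn
  convert h using 1
  funext p
  simp [b, WeylAlgebra.normalForm_single, steinS]

/-- On polynomials `G` acts by `q ↦ q' - X q`, which raises the degree of `q ≠ 0`. -/
theorem steinG_mul_eq_zero {L : WeylAlgebra ℝ} (h : steinG * L = 0) : L = 0 := by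
  refine WeylAlgebra.eq_zero_of_polyAct_eq_zero fun q => ?_
  set r := WeylAlgebra.polyAct ℝ L q with hr
  have h0 : derivative r - X * r = 0 := by
    have h1 : WeylAlgebra.polyAct ℝ (steinG * L) q = 0 := by rw [h]; simp
    rwa [steinG, map_mul, map_sub, Module.End.mul_apply, LinearMap.sub_apply,
      WeylAlgebra.polyAct_d, WeylAlgebra.polyAct_x] at h1
  by_contra hne
  have h1 : (X * r).degree ≤ r.degree := by
    rw [← sub_eq_zero.mp h0]
    exact degree_derivative_le
  have h2 : (X * r).natDegree ≤ r.natDegree := natDegree_le_natDegree h1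
  rw [natDegree_X_mul hne] at h2
  omega

/-! ### Polynomial Stein operators -/

theorem steinG_mul_mem_PSO_of_class {𝓕 : Set smoothFun}
    (h𝓕 : 𝓕 = schwartzClass ∨ 𝓕 = polyClass ∨ 𝓕 = growthClass ∨ 𝓕 = compactClass)
    (L : WeylAlgebra ℝ) : steinG * L ∈ PSO 𝓕 (gaussianReal 0 1) := by
  refine PSO_antitone ?_ _ (steinG_mul_mem_PSO L)
  rcases h𝓕 with rfl | rfl | rfl | rfl
  · exact schwartzClass_subset_growthClass
  · exact polyClass_subset_growthClass
  · exact subset_rfl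
  · exact compactClass_subset_schwartzClass.trans schwartzClass_subset_growthClass

/-- Each of the four classes contains the polynomials or the compactly supported functions. -/
theorem eq_zero_of_ofPoly_mem_PSO {𝓕 : Set smoothFun}
    (h𝓕 : 𝓕 = schwartzClass ∨ 𝓕 = polyClass ∨ 𝓕 = growthClass ∨ 𝓕 = compactClass)
    {p : ℝ[X]} (hp : WeylAlgebra.ofPoly p ∈ PSO 𝓕 (gaussianReal 0 1)) : p = 0 := by
  rcases h𝓕 with rfl | rfl | rfl | rfl
  · exact eq_zero_of_ofPoly_mem_PSO_compactClass
      (PSO_antitone compactClass_subset_schwartzClass _ hp)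
  · exact eq_zero_of_ofPoly_mem_PSO_polyClass hp
  · exact eq_zero_of_ofPoly_mem_PSO_polyClass (PSO_antitone polyClass_subset_growthClass _ hp)
  · exact eq_zero_of_ofPoly_mem_PSO_compactClass hp

theorem PSO_sub_mem {𝓕 : Set smoothFun} {μ : Measure ℝ} {S T : WeylAlgebra ℝ}
    (hS : S ∈ PSO 𝓕 μ) (hT : T ∈ PSO 𝓕 μ) : S - T ∈ PSO 𝓕 μ := by
  intro f hf
  obtain ⟨hSi, hS0⟩ := hS f hf
  obtain ⟨hTi, hT0⟩ := hT f hf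
  have h : (weylAct (S - T) f : ℝ → ℝ) = (weylAct S f : ℝ → ℝ) - (weylAct T f : ℝ → ℝ) := by
    rw [map_sub]
    rfl
  rw [h]
  refine ⟨hSi.sub hTi, ?_⟩
  simp only [Pi.sub_apply]
  rw [integral_sub hSi hTi, hS0, hT0, sub_zero]

/-- `span S(k,t) ⊆ G A₁ ⊆ PSO(N)`, and an operator in `PSO(N)` is a polynomial modulo
`span S(k,t)`, where the polynomial lies in `PSO(N)` and hence vanishes. -/
theorem steinSpan_eq_PSO_and_steinIdeal_eq_PSO (𝓕 : Set smoothFun)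
    (h𝓕 : 𝓕 = schwartzClass ∨ 𝓕 = polyClass ∨ 𝓕 = growthClass ∨ 𝓕 = compactClass) :
    (steinSpan : Set (WeylAlgebra ℝ)) = PSO 𝓕 (gaussianReal 0 1) ∧
      (steinIdeal : Set (WeylAlgebra ℝ)) = PSO 𝓕 (gaussianReal 0 1) := by
  have h₁ : ∀ S ∈ steinIdeal, S ∈ PSO 𝓕 (gaussianReal 0 1) := fun S hS => by
    obtain ⟨L, rfl⟩ := mem_steinIdeal.mp hS
    exact steinG_mul_mem_PSO_of_class h𝓕 L
  have h₂ : ∀ S ∈ PSO 𝓕 (gaussianReal 0 1), S ∈ steinSpan := fun S hS => by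
    obtain ⟨p, hpS⟩ := exists_sub_ofPoly_mem_steinSpan S
    have hmem := PSO_sub_mem hS (h₁ _ (steinSpan_subset_steinIdeal hpS))
    rw [sub_sub_cancel] at hmem
    rw [eq_zero_of_ofPoly_mem_PSO h𝓕 hmem] at hpS
    simpa [WeylAlgebra.ofPoly] using hpS
  exact ⟨Set.Subset.antisymm (fun S hS => h₁ S (steinSpan_subset_steinIdeal hS)) h₂,
    Set.Subset.antisymm h₁ fun S hS => steinSpan_subset_steinIdeal (h₂ S hS)⟩

theorem eq_zero_of_ofPoly_mem_steinIdeal {p : ℝ[X]} (hp : WeylAlgebra.ofPoly p ∈ steinIdeal) :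
    p = 0 := by
  obtain ⟨L, hL⟩ := mem_steinIdeal.mp hp
  refine eq_zero_of_ofPoly_mem_PSO_polyClass ?_
  rw [hL]
  exact PSO_antitone polyClass_subset_growthClass _ (steinG_mul_mem_PSO L)

/-- A right ideal strictly above `G A₁` contains a nonzero polynomial `p`. As
`p G = G p - p'`, it then contains `p'`, and so, after repeated differentiation, a unit. -/
theorem isCoatom_steinIdeal : IsCoatom steinIdeal := by
  constructor
  · intro h
    have h1 : WeylAlgebra.ofPoly (1 : ℝ[X]) ∈ steinIdeal := h ▸ Submodule.mem_top
    exact one_ne_zero (eq_zero_of_ofPoly_mem_steinIdeal h1)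
  · intro J hJ
    obtain ⟨hle, S, hSJ, hSI⟩ := SetLike.lt_iff_le_and_exists.mp hJ
    obtain ⟨p, hp⟩ := exists_sub_ofPoly_mem_steinSpan S
    have hpI := steinSpan_subset_steinIdeal hp
    have hpJ : WeylAlgebra.ofPoly p ∈ J := by
      have h := sub_mem hSJ (hle hpI)
      rwa [sub_sub_cancel] at h
    have hp0 : p ≠ 0 := by
      rintro rfl
      exact hSI (by simpa [WeylAlgebra.ofPoly] using hpI)
    have key : ∀ n, ∀ q : ℝ[X], q.natDegree = n → q ≠ 0 → WeylAlgebra.ofPoly q ∈ J → J = ⊤ := by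
      intro n
      induction n with
      | zero =>
        intro q hq hq0 hqJ
        obtain ⟨c, rfl⟩ : ∃ c, q = C c := ⟨_, eq_C_of_natDegree_eq_zero hq⟩
        have hc : c ≠ 0 := by simpa using hq0
        rw [eq_top_iff]
        intro w _
        have h := J.smul_mem (op (c⁻¹ • w)) hqJ
        rw [op_smul_eq_mul, mul_smul_comm, WeylAlgebra.ofPoly, aeval_C,
          ← Algebra.smul_def, inv_smul_smul₀ hc] at h
        exact h
      | succ n ih =>
        intro q hq hq0 hqJ
        have hd : (derivative q).natDegree = n := by
          rw [natDegree_derivative, hq, Nat.add_sub_cancel]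
        refine ih (derivative q) hd ?_ ?_
        · intro h
          have := derivative_eq_zero.mp h
          omega
        · have h := sub_mem (hle (steinG_mul_mem (WeylAlgebra.ofPoly q)))
            (J.smul_mem (op steinG) hqJ)
          rwa [op_smul_eq_mul, ofPoly_mul_steinG, sub_sub_cancel] at h
    exact key _ p rfl hp0 hpJ

/-! ### Bernstein dimensions -/

/-- `L ↦ G L` identifies `A₁` with `G A₁`, so that `dim G 𝓕_ν = (ν + 1)(ν + 2) / 2`. -/
theorem hasBernsteinDim_steinIdeal : HasBernsteinDim ℝ steinIdeal 2 := by
  let m : steinIdeal := ⟨steinG, Submodule.subset_span rfl⟩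
  have hm : ∀ y : steinIdeal, ∃ a : WeylAlgebra ℝ, op a • m = y := by
    rintro ⟨y, hy⟩
    obtain ⟨L, rfl⟩ := mem_steinIdeal.mp hy
    exact ⟨L, rfl⟩
  have hinj : Function.Injective (WeylFiltration.orbitMap ℝ m) := by
    rw [injective_iff_map_eq_zero]
    intro a ha
    exact steinG_mul_eq_zero (congrArg Subtype.val ha)
  refine WeylFiltration.hasBernsteinDim_of_cyclic m hm
    ⟨C (1 / 2) * ((X + C 1) * (X + C 2)), ?_, Filter.Eventually.of_forall fun ν => ?_⟩
  · rw [natDegree_C_mul (by norm_num), natDegree_mul (X_add_C_ne_zero _) (X_add_C_ne_zero _),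
      natDegree_X_add_C, natDegree_X_add_C]
  · have h : Module.finrank ℝ ((WeylFiltration.cyclic ℝ m hm).Γ ν) =
        Module.finrank ℝ (WeylAlgebra.bernstein ℝ ν) :=
      (Submodule.equivMapOfInjective _ hinj _).finrank_eq.symm
    rw [h, WeylAlgebra.finrank_bernstein]
    simp

/-- The map `p ↦ p(x) + G A₁` from polynomials to the quotient module. -/
def quotientOfPoly : ℝ[X] →ₗ[ℝ] WeylAlgebra ℝ ⧸ steinIdeal :=
  WeylFiltration.orbitMap ℝ (steinIdeal.mkQ 1) ∘ₗ (aeval (WeylAlgebra.x ℝ)).toLinearMap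

theorem quotientOfPoly_apply (p : ℝ[X]) :
    quotientOfPoly p = steinIdeal.mkQ (WeylAlgebra.ofPoly p) := by
  change op (WeylAlgebra.ofPoly p) • steinIdeal.mkQ 1 = _
  rw [← map_smul, op_smul_eq_mul, one_mul]

theorem quotientOfPoly_injective : Function.Injective quotientOfPoly := by
  rw [injective_iff_map_eq_zero]
  intro p hp
  rw [quotientOfPoly_apply, Submodule.mkQ_apply, Submodule.Quotient.mk_eq_zero] at hp
  exact eq_zero_of_ofPoly_mem_steinIdeal hp

/-- Modulo `G A₁` one has `p ∂ ≡ X p - p'`, of degree one more than `p`. -/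
theorem mkQ_ofPoly_mul_d_pow_mem (β : ℕ) {n : ℕ} {p : ℝ[X]} (hp : p ∈ degreeLT ℝ n) :
    steinIdeal.mkQ (WeylAlgebra.ofPoly p * WeylAlgebra.d ℝ ^ β) ∈
      (degreeLT ℝ (n + β)).map quotientOfPoly := by
  induction β generalizing n p with
  | zero =>
    rw [pow_zero, mul_one, ← quotientOfPoly_apply]
    exact Submodule.mem_map_of_mem hp
  | succ β ih =>
    have hp' : X * p - derivative p ∈ degreeLT ℝ (n + 1) := by
      rw [mem_degreeLT, degree_lt_iff_coeff_zero] at *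
      intro m hm
      obtain ⟨m, rfl⟩ : ∃ l, m = l + 1 := ⟨m - 1, by omega⟩
      rw [coeff_sub, coeff_X_mul, coeff_derivative, hp m (by omega), hp (m + 1 + 1) (by omega)]
      simp
    have h := ih hp'
    rw [show n + 1 + β = n + (β + 1) by omega] at h
    convert h using 1
    rw [← sub_eq_zero, ← map_sub, Submodule.mkQ_apply, Submodule.Quotient.mk_eq_zero, pow_succ',
      ← mul_assoc, ← sub_mul, ← steinG_mul_ofPoly, mul_assoc]
    exact steinG_mul_mem _

/-- The image of `𝓕_ν` in `A₁ / G A₁` is that of the polynomials of degree at most `ν`, of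
dimension `ν + 1`. -/
theorem hasBernsteinDim_quotient_steinIdeal :
    HasBernsteinDim ℝ (WeylAlgebra ℝ ⧸ steinIdeal) 1 := by
  let m : WeylAlgebra ℝ ⧸ steinIdeal := steinIdeal.mkQ 1
  have horb : ∀ a : WeylAlgebra ℝ, op a • m = steinIdeal.mkQ a := fun a => by
    rw [← map_smul, op_smul_eq_mul, one_mul]
  have hm : ∀ y, ∃ a : WeylAlgebra ℝ, op a • m = y := fun y => by
    obtain ⟨a, rfl⟩ := steinIdeal.mkQ_surjective y
    exact ⟨a, horb a⟩
  refine WeylFiltration.hasBernsteinDim_of_cyclic m hm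
    ⟨X + C 1, natDegree_X_add_C _, Filter.Eventually.of_forall fun ν => ?_⟩
  have hΓ : (WeylFiltration.cyclic ℝ m hm).Γ ν = (degreeLT ℝ (ν + 1)).map quotientOfPoly := by
    apply le_antisymm
    · refine Submodule.map_le_iff_le_comap.mpr (Submodule.span_le.mpr ?_)
      rintro _ ⟨α, β, h, rfl⟩
      have hX : (X ^ α : ℝ[X]) ∈ degreeLT ℝ (α + 1) := by
        rw [mem_degreeLT, degree_X_pow]
        exact_mod_cast Nat.lt_succ_self α
      have h' := mkQ_ofPoly_mul_d_pow_mem β hX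
      rw [WeylAlgebra.ofPoly_X_pow, ← horb] at h'
      exact Submodule.map_mono (degreeLT_mono (by omega)) h'
    · rw [degreeLT_eq_span_X_pow, Submodule.map_span, Submodule.span_le]
      rintro _ ⟨_, hq, rfl⟩
      simp only [Finset.coe_image, Set.mem_image, Finset.coe_range, Set.mem_Iio] at hq
      obtain ⟨α, hα, rfl⟩ := hq
      refine ⟨WeylAlgebra.x ℝ ^ α * WeylAlgebra.d ℝ ^ 0,
        WeylAlgebra.monomial_mem_bernstein (by omega), ?_⟩
      rw [quotientOfPoly_apply, WeylAlgebra.ofPoly_X_pow, ← horb, pow_zero, mul_one]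
      rfl
  rw [hΓ, ← (Submodule.equivMapOfInjective _ quotientOfPoly_injective _).finrank_eq,
    (degreeLTEquiv ℝ (ν + 1)).finrank_eq]
  simp

end

theorem mainTheorem1 (𝓕 : Set smoothFun)
    (h𝓕 : 𝓕 = schwartzClass ∨ 𝓕 = polyClass ∨ 𝓕 = growthClass ∨ 𝓕 = compactClass) :
    ∃ I : Submodule (WeylAlgebra ℝ)ᵐᵒᵖ (WeylAlgebra ℝ),
      (I : Set (WeylAlgebra ℝ)) = PSO 𝓕 (gaussianReal 0 1) ∧
      -- (a)
      (LinearIndependent ℝ (fun p : {p : ℕ × ℕ // 1 ≤ p.2} => steinS p.1.1 p.1.2) ∧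
        (Submodule.span ℝ
          (Set.range fun p : {p : ℕ × ℕ // 1 ≤ p.2} => steinS p.1.1 p.1.2) :
            Set (WeylAlgebra ℝ)) = PSO 𝓕 (gaussianReal 0 1)) ∧
      -- (b)
      (I = Submodule.span (WeylAlgebra ℝ)ᵐᵒᵖ {steinG} ∧
        (I : Set (WeylAlgebra ℝ)) = {S | ∃ L : WeylAlgebra ℝ, S = steinG * L} ∧
        IsCoatom I) ∧
      -- (c)
      (¬ IsHolonomic ℝ I ∧ HasBernsteinDim ℝ I 2 ∧
        IsHolonomic ℝ (WeylAlgebra ℝ ⧸ I) ∧ HasBernsteinDim ℝ (WeylAlgebra ℝ ⧸ I) 1) := by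
  obtain ⟨hspan, hideal⟩ := steinSpan_eq_PSO_and_steinIdeal_eq_PSO 𝓕 h𝓕
  refine ⟨steinIdeal, hideal, ⟨linearIndependent_steinS, hspan⟩,
    ⟨rfl, Set.ext fun S => mem_steinIdeal, isCoatom_steinIdeal⟩, fun h => ?_,
    hasBernsteinDim_steinIdeal, hasBernsteinDim_quotient_steinIdeal,
    hasBernsteinDim_quotient_steinIdeal⟩
  exact absurd (hasBernsteinDim_steinIdeal.unique h) (by norm_num)
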